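/- Let $(E,\mathcal E,\mu)$ be a probability space, let $\Omega=\prod_{k\ge 1}E$ carry the product $\sigma$-algebra and the product measure $\mathbb P=\bigotimes_{k\ge1}\mu$, and let $\theta:\Omega\to\Omega$, $(x_1,x_2,x_3,\dots)\mapsto(x_2,x_3,\dots)$ be the shift (which preserves $\mathbb P$). For $r\ge 1$ let $\mathcal F_r$ be the $\sigma$-algebra generated by the first $r$ coordinate projections. Let $f\in L^2(\Omega,\mathbb P)$ be real-valued with $\int f\,d\mathbb P=0$, and put $f_r=\mathbb E[f\mid\mathcal F_r]$ and $\varphi_r=f-f_r$. Suppose that $\sum_{r\ge1}\|\varphi_r\|_2<\infty$. Then the limit $$\sigma^2=\lim_{n\to\infty}\frac1n\,\mathbb E\Big[\Big(\sum_{k=0}^{n-1}f\circ\theta^k\Big)^2\Big]$$ exists in $[0,\infty)$, and if $\sigma^2\neq0$ (with $\sigma>0$), then for every $t\in\mathbb R$ $$\mathbb P\Big[\frac1{\sqrt n}\sum_{k=0}^{n-1}f\circ\theta^k\le t\Big]\longrightarrow\frac1{\sigma\sqrt{2\pi}}\int_{-\infty}^t e^{-u^2/(2\sigma^2)}\,du\qquad(n\to\infty),$$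 that is, $n^{-1/2}\sum_{k=0}^{n-1}f\circ\theta^k$ converges in law to $N(0,\sigma^2)$. -/

import Mathlib

open MeasureTheory ProbabilityTheory Filter Topology
open scoped ENNReal

namespace ShiftCLT

variable {E : Type*}

/-- The shift `(x₁, x₂, x₃, …) ↦ (x₂, x₃, …)` on sequences; coordinates are numbered from `0`,
so that `ω j` is the coordinate `x_{j+1}`. -/
def shift (ω : ℕ → E) : ℕ → E := fun j => ω (j + 1)

/-- The product measure `⊗_{k ≥ 1} μ` on the sequence space `ℕ → E` with the product
`σ`-algebra. -/
noncomputable def prodMeasure [MeasurableSpace E] (μ : Measure E) [IsProbabilityMeasure μ] :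
    Measure (ℕ → E) :=
  Measure.infinitePi fun _ : ℕ => μ

instance [MeasurableSpace E] (μ : Measure E) [IsProbabilityMeasure μ] :
    IsProbabilityMeasure (prodMeasure μ) := by
  unfold prodMeasure; infer_instance

/-- `firstCoords r` is the `σ`-algebra generated by the first `r` coordinate projections. -/
abbrev firstCoords (E : Type*) [MeasurableSpace E] (r : ℕ) : MeasurableSpace (ℕ → E) :=
  ⨆ (j : ℕ) (_ : j < r), MeasurableSpace.comap (fun ω : ℕ → E => ω j) inferInstance

/-- `f_r = 𝔼[f | F_r]`, with `F_r` the `σ`-algebra of the first `r` coordinates. -/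
noncomputable def approx [MeasurableSpace E] (μ : Measure E) [IsProbabilityMeasure μ]
    (f : (ℕ → E) → ℝ) (r : ℕ) : (ℕ → E) → ℝ :=
  (prodMeasure μ)[f | firstCoords E r]

/-- `φ_r = f - f_r`. -/
noncomputable def remainder [MeasurableSpace E] (μ : Measure E) [IsProbabilityMeasure μ]
    (f : (ℕ → E) → ℝ) (r : ℕ) : (ℕ → E) → ℝ :=
  fun ω => f ω - approx μ f r ω

/-- The ergodic sum `∑_{k=0}^{n-1} f ∘ θ^k`, with `θ` the shift. -/
def ergodicSum (f : (ℕ → E) → ℝ) (n : ℕ) (ω : ℕ → E) : ℝ :=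
  ∑ k ∈ Finset.range n, f (shift^[k] ω)

/-- The `σ`-algebra of the first `r` coordinates is coarser than the product `σ`-algebra. -/
theorem firstCoords_le [MeasurableSpace E] (r : ℕ) :
    firstCoords E r ≤ MeasurableSpace.pi :=
  iSup₂_le fun j _ => (measurable_pi_apply j).comap_le

/-- The shift preserves the product measure. -/
theorem measurePreserving_shift [MeasurableSpace E] (μ : Measure E) [IsProbabilityMeasure μ] :
    MeasurePreserving (shift (E := E)) (prodMeasure μ) (prodMeasure μ) := by
  have hm : Measurable (shift (E := E)) :=
    measurable_pi_lambda _ fun j => measurable_pi_apply (j + 1)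
  refine ⟨hm, ?_⟩
  refine Measure.eq_infinitePi (fun _ : ℕ => μ) fun s t ht => ?_
  classical
  rw [Measure.map_apply hm (MeasurableSet.pi s.countable_toSet fun i _ => ht i)]
  have h : shift (E := E) ⁻¹' (Set.pi s t) =
      Set.pi (s.map (addRightEmbedding 1)) (fun i => t (i - 1)) := by
    ext ω
    simp [shift, Set.mem_pi]
  rw [h, prodMeasure, Measure.infinitePi_pi _ (fun i _ => ht (i - 1))]
  simp

end ShiftCLT

/-! The proof cuts time into blocks of length `p`. Inside a block, `f ∘ θ^k` is replaced by its
conditional expectation on what remains of the block, `f_{p-k} ∘ θ^k`. The resulting `blockSum μ f p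
p` depends only on the `p` coordinates of the block, so its translates by multiples of `p` are
i.i.d. and the classical central limit theorem applies to them for fixed `p`.

The error in one block has `L²` norm at most `A = ∑ ‖φ_r‖₂`, whatever `p` is. Errors of different
blocks are nearly orthogonal: up to a function of the first `(j+1)p` coordinates, which is
orthogonal to the block starting there, the error of the initial block is a sum of `φ_r ∘ θ^k` with
`jp < r ≤ (j+1)p`. The covariances therefore sum to at most `A²`, uniformly in `p`, and `N` blocks
produce a total error of norm at most `√3 A √N` (`lpNorm_sum_blockRemainder_le`). Since `N ≤ n/p`,
normalization by `√n` leaves `√3 A / √p`; the incomplete last block is negligible.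

Thus the normalized sum is within `O(1/√p)` in `L²` of a sequence with Gaussian limit, for `n` large
depending on `p`. Letting `p → ∞` (`exists_tendsto_of_approx`) gives both the limiting variance and
the limiting characteristic function. Characteristic functions are used until the very end because
the block variances, or `σ` itself, may vanish. -/

namespace ShiftCLT

/-! ### `L²` norms, characteristic functions and limits on a general probability space. -/

section General

variable {Ω : Type*} {mΩ : MeasurableSpace Ω} {P : Measure Ω}

theorem lpNorm_two_sq {g : Ω → ℝ} (hg : MemLp g 2 P) :
    lpNorm g 2 P ^ 2 = ∫ ω, g ω ^ 2 ∂P := by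
  rw [lpNorm_eq_integral_norm_rpow_toReal (by norm_num) (by norm_num) hg.1]
  have h0 : 0 ≤ ∫ ω, g ω ^ 2 ∂P := integral_nonneg fun _ => sq_nonneg _
  simp only [ENNReal.toReal_ofNat, Real.rpow_ofNat, Real.norm_eq_abs, sq_abs]
  rw [← Real.rpow_natCast, ← Real.rpow_mul h0]
  norm_num

theorem lpNorm_two_eq_sqrt {g : Ω → ℝ} (hg : MemLp g 2 P) :
    lpNorm g 2 P = √(∫ ω, g ω ^ 2 ∂P) := by
  rw [← lpNorm_two_sq hg, Real.sqrt_sq lpNorm_nonneg]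

theorem integrable_fun_mul {f g : Ω → ℝ} (hf : MemLp f 2 P)
    (hg : MemLp g 2 P) : Integrable (fun ω => f ω * g ω) P :=
  hf.integrable_mul hg

theorem abs_integral_mul_le {f g : Ω → ℝ} (hf : MemLp f 2 P) (hg : MemLp g 2 P) :
    |∫ ω, f ω * g ω ∂P| ≤ lpNorm f 2 P * lpNorm g 2 P := by
  have hp : Real.HolderConjugate 2 2 := Real.HolderConjugate.two_two
  have h := integral_mul_le_Lp_mul_Lq_of_nonneg (μ := P) hp (f := fun ω => |f ω|)
    (g := fun ω => |g ω|) (ae_of_all _ fun _ => abs_nonneg _) (ae_of_all _ fun _ => abs_nonneg _)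
    (by rw [ENNReal.ofReal_ofNat]; exact hf.abs)
    (by rw [ENNReal.ofReal_ofNat]; exact hg.abs)
  rw [lpNorm_two_eq_sqrt hf, lpNorm_two_eq_sqrt hg, Real.sqrt_eq_rpow, Real.sqrt_eq_rpow]
  simp only [Real.rpow_ofNat, sq_abs] at h
  refine (abs_integral_le_integral_abs).trans ?_
  simpa only [abs_mul] using h

theorem lpNorm_comp_measurePreserving {Ω' : Type*} {mΩ' : MeasurableSpace Ω'} {P' : Measure Ω'}
    {g : Ω' → ℝ} {T : Ω → Ω'} {p : ℝ≥0∞} (hg : AEStronglyMeasurable g P')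
    (hT : MeasurePreserving T P P') :
    lpNorm (fun ω => g (T ω)) p P = lpNorm g p P' := by
  change lpNorm (g ∘ T) p P = _
  rw [← toReal_eLpNorm (hg.comp_measurePreserving hT), ← toReal_eLpNorm hg]
  exact congrArg _ (eLpNorm_comp_measurePreserving hg hT)

theorem integral_comp_measurePreserving {Ω' : Type*} {mΩ' : MeasurableSpace Ω'} {P' : Measure Ω'}
    {g : Ω' → ℝ} {T : Ω → Ω'} (hg : AEStronglyMeasurable g P') (hT : MeasurePreserving T P P') :
    ∫ ω, g (T ω) ∂P = ∫ ω, g ω ∂P' := by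
  rw [← integral_map hT.aemeasurable (hT.map_eq ▸ hg), hT.map_eq]

theorem lpNorm_fun_const_mul (c : ℝ) (g : Ω → ℝ) (p : ℝ≥0∞) :
    lpNorm (fun ω => c * g ω) p P = |c| * lpNorm g p P :=
  lpNorm_const_smul c g P

theorem abs_lpNorm_sub_le {X Y : Ω → ℝ} (hX : MemLp X 2 P) (hY : MemLp Y 2 P) :
    |lpNorm X 2 P - lpNorm Y 2 P| ≤ lpNorm (fun ω => X ω - Y ω) 2 P := by
  rw [abs_sub_le_iff]
  have h1 := lpNorm_le_lpNorm_add_lpNorm_sub' (f := X) hY (one_le_two)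
  have h2 := lpNorm_le_lpNorm_add_lpNorm_sub (f := Y) hX (one_le_two)
  constructor
  · exact sub_le_iff_le_add'.2 h1
  · exact sub_le_iff_le_add'.2 h2

variable [IsProbabilityMeasure P]

/-- The map `x ↦ exp (i x)` is 1-Lipschitz on the line, and on a probability space the `L¹` norm is
at most the `L²` norm. This transfers `L²` approximation to characteristic functions. -/
theorem norm_charFun_map_sub_le {X Y : Ω → ℝ} (hX : MemLp X 2 P) (hY : MemLp Y 2 P) (t : ℝ) :
    ‖charFun (P.map X) t - charFun (P.map Y) t‖ ≤ |t| * lpNorm (fun ω => X ω - Y ω) 2 P := by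
  have hXm := hX.1.aemeasurable
  have hYm := hY.1.aemeasurable
  have hi : ∀ Z : Ω → ℝ, AEMeasurable Z P →
      Integrable (fun ω => Complex.exp ((t * Z ω : ℝ) * Complex.I)) P := fun Z hZ => by
    refine Integrable.of_bound (C := 1) ?_ (ae_of_all _ fun ω => ?_)
    · exact (by fun_prop : AEMeasurable _ P).aestronglyMeasurable
    · rw [Complex.norm_exp_ofReal_mul_I]
  have he : ∀ Z : Ω → ℝ, AEMeasurable Z P →
      charFun (P.map Z) t = ∫ ω, Complex.exp ((t * Z ω : ℝ) * Complex.I) ∂P := fun Z hZ => by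
    rw [charFun_apply_real, integral_map hZ (by fun_prop)]
    simp
  have hD := hX.sub hY
  rw [he X hXm, he Y hYm, ← integral_sub (hi X hXm) (hi Y hYm)]
  have hpt : ∀ a b : ℝ, ‖Complex.exp (a * Complex.I) - Complex.exp (b * Complex.I)‖ ≤ |a - b| := by
    intro a b
    have : Complex.exp (a * Complex.I) - Complex.exp (b * Complex.I) =
        Complex.exp (b * Complex.I) * (Complex.exp (Complex.I * ((a - b : ℝ) : ℂ)) - 1) := by
      rw [mul_sub, ← Complex.exp_add]
      push_cast
      ring_nf
    rw [this, norm_mul, Complex.norm_exp_ofReal_mul_I, one_mul]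
    exact Real.norm_exp_I_mul_ofReal_sub_one_le
  calc _ ≤ ∫ ω, |t| * |X ω - Y ω| ∂P := by
        refine norm_integral_le_of_norm_le ((hD.integrable one_le_two).abs.const_mul _)
          (ae_of_all _ fun ω => (hpt _ _).trans_eq ?_)
        rw [← mul_sub, abs_mul]
    _ = |t| * ∫ ω, |X ω - Y ω| * 1 ∂P := by simp [integral_const_mul]
    _ ≤ |t| * (lpNorm (fun ω => |X ω - Y ω|) 2 P * lpNorm (fun _ : Ω => (1 : ℝ)) 2 P) := by
        gcongr
        exact (le_abs_self _).trans (abs_integral_mul_le hD.abs (memLp_const 1))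
    _ = _ := by
        congr 1
        have : lpNorm (fun _ : Ω => (1 : ℝ)) 2 P = 1 := by
          simp [lpNorm_two_eq_sqrt (memLp_const (1 : ℝ))]
        rw [this, mul_one]
        exact lpNorm_abs hD.1 2

/-- If a sequence is approximated in `L²`, uniformly up to `ε p`, by sequences `W p` whose
characteristic functions converge to those of centred Gaussians of standard deviation `s p`, and
if `ε p → 0`, then its `L²` norms converge to some `σ`, and its characteristic functions to
those of the centred Gaussian of variance `σ ^ 2`. -/
theorem exists_tendsto_of_approx {X : ℕ → Ω → ℝ} {W : ℕ → ℕ → Ω → ℝ} {s ε : ℕ → ℝ}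
    (hX : ∀ n, MemLp (X n) 2 P) (hW : ∀ p n, MemLp (W p n) 2 P)
    (hε : Tendsto ε atTop (𝓝 0))
    (hXW : ∀ p, ∀ᶠ n in atTop, lpNorm (fun ω => X n ω - W p n ω) 2 P ≤ ε p)
    (hs : ∀ p, Tendsto (fun n => lpNorm (W p n) 2 P) atTop (𝓝 (s p)))
    (hc : ∀ p t, Tendsto (fun n => charFun (P.map (W p n)) t) atTop
      (𝓝 (Complex.exp (-((s p : ℂ) ^ 2 * t ^ 2 / 2))))) :
    ∃ σ : ℝ, 0 ≤ σ ∧ Tendsto (fun n => lpNorm (X n) 2 P) atTop (𝓝 σ) ∧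
      ∀ t : ℝ, Tendsto (fun n => charFun (P.map (X n)) t) atTop
        (𝓝 (Complex.exp (-((σ : ℂ) ^ 2 * t ^ 2 / 2)))) := by
  -- The term `1 / (p + 1)` makes the bound strictly positive even when `ε p = 0`; the second `ε p`
  -- is only slack.
  have hclose : ∀ p, ∀ᶠ n in atTop, |lpNorm (X n) 2 P - s p| < ε p + ε p + 1 / (p + 1) := by
    intro p
    have h1 : (0 : ℝ) < 1 / (p + 1) := by positivity
    filter_upwards [hXW p, Metric.tendsto_nhds.1 (hs p) _ h1] with n hn hn'
    have h2 := abs_lpNorm_sub_le (hX n) (hW p n)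
    rw [Real.dist_eq] at hn'
    have h3 := abs_sub_le (lpNorm (X n) 2 P) (lpNorm (W p n) 2 P) (s p)
    have h4 : 0 ≤ ε p := lpNorm_nonneg.trans hn
    linarith
  have hδ : Tendsto (fun p : ℕ => ε p + ε p + 1 / ((p : ℝ) + 1)) atTop (𝓝 0) := by
    simpa using (hε.add hε).add tendsto_one_div_add_atTop_nhds_zero_nat
  have hcau : CauchySeq fun n => lpNorm (X n) 2 P := by
    rw [Metric.cauchySeq_iff']
    intro e he
    obtain ⟨p, hp⟩ := ((tendsto_order.1 hδ).2 (e / 2) (by positivity)).exists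
    obtain ⟨n₀, hn₀⟩ := eventually_atTop.1 (hclose p)
    refine ⟨n₀, fun n hn => ?_⟩
    rw [Real.dist_eq]
    have h1 := hn₀ n hn
    have h2 := hn₀ n₀ le_rfl
    have h3 := abs_sub_le (lpNorm (X n) 2 P) (s p) (lpNorm (X n₀) 2 P)
    rw [abs_sub_comm (s p)] at h3
    linarith
  obtain ⟨σ, hσ⟩ := cauchySeq_tendsto_of_complete hcau
  refine ⟨σ, ge_of_tendsto' hσ fun n => lpNorm_nonneg, hσ, fun t => ?_⟩
  have hsσ : Tendsto s atTop (𝓝 σ) := by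
    rw [tendsto_iff_dist_tendsto_zero]
    refine squeeze_zero (fun _ => dist_nonneg) (fun p => ?_) hδ
    rw [Real.dist_eq, abs_sub_comm]
    exact le_of_tendsto ((hσ.sub_const (s p)).abs) ((hclose p).mono fun n hn => hn.le)
  have hg : Tendsto (fun p => Complex.exp (-((s p : ℂ) ^ 2 * t ^ 2 / 2))) atTop
      (𝓝 (Complex.exp (-((σ : ℂ) ^ 2 * t ^ 2 / 2)))) := by
    have hcont : Continuous fun x : ℝ => Complex.exp (-((x : ℂ) ^ 2 * t ^ 2 / 2)) := by fun_prop
    exact (hcont.tendsto σ).comp hsσ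
  have hε' : Tendsto (fun p => |t| * ε p) atTop (𝓝 0) := by simpa using hε.const_mul |t|
  rw [Metric.tendsto_nhds]
  intro e he
  obtain ⟨p, hp1, hp2⟩ := (((tendsto_order.1 hε').2 (e / 3) (by positivity)).and
    (Metric.tendsto_nhds.1 hg (e / 3) (by positivity))).exists
  filter_upwards [hXW p, Metric.tendsto_nhds.1 (hc p t) (e / 3) (by positivity)] with n h1 h2
  have h3 := norm_charFun_map_sub_le (hX n) (hW p n) t
  rw [← dist_eq_norm] at h3
  have h4 := dist_triangle4 (charFun (P.map (X n)) t) (charFun (P.map (W p n)) t)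
    (Complex.exp (-((s p : ℂ) ^ 2 * t ^ 2 / 2))) (Complex.exp (-((σ : ℂ) ^ 2 * t ^ 2 / 2)))
  have h5 : |t| * lpNorm (fun ω => X n ω - W p n ω) 2 P ≤ |t| * ε p := by gcongr
  linarith

/-- Convergence of characteristic functions to those of a nondegenerate centred Gaussian implies
pointwise convergence of distribution functions. -/
theorem tendsto_measureReal_le_of_tendsto_charFun {X : ℕ → Ω → ℝ} {σ : ℝ} (hσ : 0 < σ)
    (hX : ∀ n, AEMeasurable (X n) P)
    (h : ∀ t : ℝ, Tendsto (fun n => charFun (P.map (X n)) t) atTop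
        (𝓝 (Complex.exp (-((σ : ℂ) ^ 2 * t ^ 2 / 2))))) (t : ℝ) :
    Tendsto (fun n => P.real {ω | X n ω ≤ t}) atTop
      (𝓝 ((1 / (σ * √(2 * Real.pi))) *
        ∫ u in Set.Iic t, Real.exp (-(u ^ 2) / (2 * σ ^ 2)))) := by
  have hv : Real.toNNReal (σ ^ 2) ≠ 0 := by
    simpa using hσ.ne'
  let ν : ℕ → ProbabilityMeasure ℝ :=
    fun n => ⟨P.map (X n), Measure.isProbabilityMeasure_map (hX n)⟩
  let γ : ProbabilityMeasure ℝ := ⟨gaussianReal 0 (Real.toNNReal (σ ^ 2)), inferInstance⟩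
  have hlim : Tendsto ν atTop (𝓝 γ) := by
    refine ProbabilityMeasure.tendsto_iff_tendsto_charFun.2 fun t => ?_
    have : charFun (γ : Measure ℝ) t = Complex.exp (-((σ : ℂ) ^ 2 * t ^ 2 / 2)) := by
      change charFun (gaussianReal 0 (Real.toNNReal (σ ^ 2))) t = _
      rw [charFun_gaussianReal]
      have : (((Real.toNNReal (σ ^ 2) : NNReal) : ℝ) : ℂ) = (σ : ℂ) ^ 2 := by
        rw [Real.coe_toNNReal _ (sq_nonneg σ)]; push_cast; rfl
      rw [show ((Real.toNNReal (σ ^ 2) : NNReal) : ℂ) = (σ : ℂ) ^ 2 from this]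
      simp
    rw [this]
    exact h t
  have := nullSingletonClass_gaussianReal (μ := 0) hv
  -- Nondegeneracy enters here: a Gaussian of positive variance has no atom at `t`.
  have hnull : (γ : Measure ℝ) (frontier (Set.Iic t)) = 0 := by
    rw [frontier_Iic]
    exact measure_singleton (μ := gaussianReal 0 (Real.toNNReal (σ ^ 2))) t
  have key := ProbabilityMeasure.tendsto_measure_of_null_frontier_of_tendsto' hlim hnull
  have key' := (ENNReal.tendsto_toReal (measure_ne_top _ _)).comp key
  have hval : ((γ : Measure ℝ) (Set.Iic t)).toReal = (1 / (σ * √(2 * Real.pi))) *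
        ∫ u in Set.Iic t, Real.exp (-(u ^ 2) / (2 * σ ^ 2)) := by
    change (gaussianReal 0 (Real.toNNReal (σ ^ 2)) (Set.Iic t)).toReal = _
    rw [gaussianReal_apply_eq_integral _ hv,
      ENNReal.toReal_ofReal (integral_nonneg fun _ => gaussianPDFReal_nonneg _ _ _),
      ← integral_const_mul]
    congr 1 with u
    rw [gaussianPDFReal, Real.coe_toNNReal _ (sq_nonneg σ), mul_comm (2 * Real.pi),
      Real.sqrt_mul (sq_nonneg σ), Real.sqrt_sq hσ.le, sub_zero, one_div]
  rw [hval] at key'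
  refine key'.congr fun n => ?_
  change ((P.map (X n)) (Set.Iic t)).toReal = _
  rw [Measure.map_apply_of_aemeasurable (hX n) measurableSet_Iic]
  rfl

end General

/-! ### The shift: measurability, independence and orthogonality. -/

section Shift

variable {E : Type*}

theorem shift_iterate_apply (k : ℕ) (ω : ℕ → E) (j : ℕ) : (shift^[k] ω) j = ω (j + k) := by
  induction k generalizing ω with
  | zero => rfl
  | succ k ih => rw [Function.iterate_succ_apply, ih]; simp only [shift]; congr 1

theorem shift_iterate_iterate (k l : ℕ) (ω : ℕ → E) :
    shift^[k] (shift^[l] ω) = shift^[k + l] ω :=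
  (Function.iterate_add_apply shift k l ω).symm

variable [MeasurableSpace E]

theorem firstCoords_mono {q r : ℕ} (h : q ≤ r) : firstCoords E q ≤ firstCoords E r :=
  iSup₂_le fun j hj => le_iSup₂_of_le (f := fun (j : ℕ) (_ : j < r) =>
    MeasurableSpace.comap (fun ω : ℕ → E => ω j) inferInstance) j (hj.trans_le h) le_rfl

/-- Shifting by `k` turns functions of the first `r` coordinates into functions of the first
`r + k` coordinates. -/
theorem measurable_shift_iterate_firstCoords {k r q : ℕ} (h : r + k ≤ q) :
    Measurable[firstCoords E q, firstCoords E r] (shift^[k] : (ℕ → E) → ℕ → E) := by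
  rw [measurable_iff_comap_le, firstCoords, MeasurableSpace.comap_iSup]
  refine iSup_le fun j => ?_
  rw [MeasurableSpace.comap_iSup]
  refine iSup_le fun hj => ?_
  rw [MeasurableSpace.comap_comp]
  have : ((fun ω : ℕ → E => ω j) ∘ shift^[k]) = fun ω : ℕ → E => ω (j + k) := by
    funext ω
    exact shift_iterate_apply k ω j
  rw [this]
  exact le_iSup₂_of_le (f := fun (j : ℕ) (_ : j < q) =>
    MeasurableSpace.comap (fun ω : ℕ → E => ω j) inferInstance) (j + k) (by omega) le_rfl

theorem stronglyMeasurable_comp_shift_iterate {h : (ℕ → E) → ℝ} {k r q : ℕ}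
    (hh : StronglyMeasurable[firstCoords E r] h) (hkq : r + k ≤ q) :
    StronglyMeasurable[firstCoords E q] (fun ω => h (shift^[k] ω)) :=
  hh.comp_measurable (measurable_shift_iterate_firstCoords hkq)

variable (μ : Measure E) [IsProbabilityMeasure μ]

theorem measurePreserving_shift_iterate (k : ℕ) :
    MeasurePreserving (shift^[k]) (prodMeasure μ) (prodMeasure μ) :=
  (measurePreserving_shift μ).iterate k

/-- The two `σ`-algebras are generated by coordinates with indices in the disjoint sets `j < k` and
`j ≥ k`. -/
theorem indep_firstCoords_comap_shift_iterate (k : ℕ) :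
    Indep (firstCoords E k) (MeasurableSpace.comap shift^[k] MeasurableSpace.pi)
      (prodMeasure μ) := by
  have hi : iIndep (fun j : ℕ => MeasurableSpace.comap (fun ω : ℕ → E => ω j) inferInstance)
      (prodMeasure μ) :=
    (iIndepFun_infinitePi (P := fun _ : ℕ => μ) (X := fun _ x => x) fun _ => measurable_id).iIndep
  have h := indep_iSup_of_disjoint (fun j => (measurable_pi_apply j).comap_le) hi
    (S := {j | j < k}) (T := {j | k ≤ j}) (Set.disjoint_left.2 fun j hj hj' => by
      simp only [Set.mem_ofPred_eq] at hj hj'; omega)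
  refine indep_of_indep_of_le_right h ?_
  rw [MeasurableSpace.pi, MeasurableSpace.comap_iSup]
  refine iSup_le fun j => ?_
  rw [MeasurableSpace.comap_comp]
  have : ((fun ω : ℕ → E => ω j) ∘ shift^[k]) = fun ω : ℕ → E => ω (j + k) := by
    funext ω
    exact shift_iterate_apply k ω j
  change MeasurableSpace.comap ((fun ω : ℕ → E => ω j) ∘ shift^[k]) _ ≤ _
  rw [this]
  exact le_iSup₂_of_le (f := fun (j : ℕ) (_ : j ∈ {j | k ≤ j}) =>
    MeasurableSpace.comap (fun ω : ℕ → E => ω j) inferInstance) (j + k)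
    (Nat.le_add_left k j) le_rfl

variable {μ}

theorem memLp_comp_shift_iterate {g : (ℕ → E) → ℝ} (hg : MemLp g 2 (prodMeasure μ)) (k : ℕ) :
    MemLp (fun ω => g (shift^[k] ω)) 2 (prodMeasure μ) :=
  hg.comp_measurePreserving (measurePreserving_shift_iterate μ k)

theorem lpNorm_comp_shift_iterate {g : (ℕ → E) → ℝ} (hg : MemLp g 2 (prodMeasure μ)) (k : ℕ) :
    lpNorm (fun ω => g (shift^[k] ω)) 2 (prodMeasure μ) = lpNorm g 2 (prodMeasure μ) :=
  lpNorm_comp_measurePreserving hg.1 (measurePreserving_shift_iterate μ k)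

theorem integral_comp_shift_iterate {g : (ℕ → E) → ℝ} (hg : MemLp g 2 (prodMeasure μ)) (k : ℕ) :
    ∫ ω, g (shift^[k] ω) ∂(prodMeasure μ) = ∫ ω, g ω ∂(prodMeasure μ) :=
  integral_comp_measurePreserving hg.1 (measurePreserving_shift_iterate μ k)

/-- A function of the first `q` coordinates is orthogonal to `g ∘ θ^q` if `g` is centred. -/
theorem integral_mul_comp_shift_iterate_eq_zero {g h : (ℕ → E) → ℝ} {q : ℕ}
    (hg : MemLp g 2 (prodMeasure μ)) (hg0 : ∫ ω, g ω ∂(prodMeasure μ) = 0)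
    (hh : StronglyMeasurable[firstCoords E q] h) :
    ∫ ω, h ω * g (shift^[q] ω) ∂(prodMeasure μ) = 0 := by
  have hmp := measurePreserving_shift_iterate μ q
  -- `g` is only a.e. strongly measurable, while independence of `σ`-algebras needs a genuinely
  -- measurable version.
  obtain ⟨g', hg'm, hgg'⟩ := hg.1
  have hcongr : (fun ω => g (shift^[q] ω)) =ᵐ[prodMeasure μ] fun ω => g' (shift^[q] ω) :=
    hmp.quasiMeasurePreserving.ae_eq_comp hgg'
  have hint : ∫ ω, g' (shift^[q] ω) ∂(prodMeasure μ) = 0 := by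
    rw [← integral_congr_ae hcongr, integral_comp_shift_iterate hg, hg0]
  have hind : IndepFun h (fun ω => g' (shift^[q] ω)) (prodMeasure μ) := by
    rw [IndepFun_iff_Indep]
    refine indep_of_indep_of_le (indep_firstCoords_comap_shift_iterate μ q)
      (measurable_iff_comap_le.1 hh.measurable) ?_
    change MeasurableSpace.comap (g' ∘ shift^[q]) _ ≤ _
    rw [← MeasurableSpace.comap_comp]
    exact MeasurableSpace.comap_mono (measurable_iff_comap_le.1 hg'm.measurable)
  calc _ = ∫ ω, h ω * g' (shift^[q] ω) ∂(prodMeasure μ) := by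
        refine integral_congr_ae ?_
        filter_upwards [hcongr] with ω hω
        rw [hω]
    _ = (∫ ω, h ω ∂(prodMeasure μ)) * ∫ ω, g' (shift^[q] ω) ∂(prodMeasure μ) :=
        hind.integral_fun_mul_eq_mul_integral (hh.mono (firstCoords_le q)).aestronglyMeasurable
          (hg'm.comp_measurable hmp.measurable).aestronglyMeasurable
    _ = 0 := by rw [hint, mul_zero]

/-- Since `h` is orthogonal to `g ∘ θ^q`, it may be subtracted from `D` before applying
Cauchy–Schwarz. -/
theorem abs_integral_mul_comp_shift_iterate_le {D g h : (ℕ → E) → ℝ} {q : ℕ}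
    (hD : MemLp D 2 (prodMeasure μ))
    (hg : MemLp g 2 (prodMeasure μ)) (hg0 : ∫ ω, g ω ∂(prodMeasure μ) = 0)
    (hh : StronglyMeasurable[firstCoords E q] h) (hh2 : MemLp h 2 (prodMeasure μ)) :
    |∫ ω, D ω * g (shift^[q] ω) ∂(prodMeasure μ)| ≤
      lpNorm (fun ω => D ω - h ω) 2 (prodMeasure μ) * lpNorm g 2 (prodMeasure μ) := by
  have hgq := memLp_comp_shift_iterate hg q
  have : ∫ ω, D ω * g (shift^[q] ω) ∂(prodMeasure μ) =
      ∫ ω, (D ω - h ω) * g (shift^[q] ω) ∂(prodMeasure μ) := by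
    simp_rw [sub_mul]
    rw [integral_sub (integrable_fun_mul hD hgq) (integrable_fun_mul hh2 hgq),
      integral_mul_comp_shift_iterate_eq_zero hg hg0 hh, sub_zero]
  rw [this, ← lpNorm_comp_shift_iterate hg q]
  exact abs_integral_mul_le (hD.sub hh2) hgq

/-- Bound on the second moment of a stationary sum in terms of summable covariances. -/
theorem lpNorm_sum_comp_shift_sq_le {g : (ℕ → E) → ℝ} {p : ℕ} {b : ℕ → ℝ} {B : ℝ}
    (hg : MemLp g 2 (prodMeasure μ))
    (hb : ∀ j, |∫ ω, g ω * g (shift^[(j + 1) * p] ω) ∂(prodMeasure μ)| ≤ b j)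
    (hB : ∀ n, ∑ j ∈ Finset.range n, b j ≤ B) (n : ℕ) :
    lpNorm (fun ω => ∑ j ∈ Finset.range n, g (shift^[j * p] ω)) 2 (prodMeasure μ) ^ 2 ≤
      n * (lpNorm g 2 (prodMeasure μ) ^ 2 + 2 * B) := by
  have hS : ∀ n, MemLp (fun ω => ∑ j ∈ Finset.range n, g (shift^[j * p] ω)) 2
      (prodMeasure μ) := fun n => memLp_finsetSum _ fun j _ => memLp_comp_shift_iterate hg _
  induction n with
  | zero => simp
  | succ n ih =>
    set S : (ℕ → E) → ℝ := fun ω => ∑ j ∈ Finset.range n, g (shift^[j * p] ω) with hSdef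
    have hSp : MemLp (fun ω => S (shift^[p] ω)) 2 (prodMeasure μ) :=
      memLp_comp_shift_iterate (hS n) p
    have hSp' : ∀ ω, S (shift^[p] ω) = ∑ j ∈ Finset.range n, g (shift^[(j + 1) * p] ω) := by
      intro ω
      refine Finset.sum_congr rfl fun j _ => ?_
      rw [shift_iterate_iterate, add_one_mul]
    -- The first term is peeled off, not the last: the rest is the previous sum composed with `θ^p`,
    -- which has the same norm, and the cross term contains exactly the covariances bounded by `b`.
    have hsucc : ∀ ω, ∑ j ∈ Finset.range (n + 1), g (shift^[j * p] ω) =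
        g ω + S (shift^[p] ω) := by
      intro ω
      rw [Finset.sum_range_succ', hSp' ω, add_comm]
      simp
    simp_rw [hsucc]
    have hcross : ∫ ω, g ω * S (shift^[p] ω) ∂(prodMeasure μ) ≤ B := by
      simp_rw [hSp', Finset.mul_sum]
      rw [integral_finsetSum _ fun j _ => integrable_fun_mul hg (memLp_comp_shift_iterate hg _)]
      exact (Finset.sum_le_sum fun j _ => (le_abs_self _).trans (hb j)).trans (hB n)
    have hexp : ∫ ω, (g ω + S (shift^[p] ω)) ^ 2 ∂(prodMeasure μ) =
        ∫ ω, g ω ^ 2 ∂(prodMeasure μ) + 2 * ∫ ω, g ω * S (shift^[p] ω) ∂(prodMeasure μ) +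
          ∫ ω, S (shift^[p] ω) ^ 2 ∂(prodMeasure μ) := by
      have h1 := hg.integrable_sq
      have h2 := (integrable_fun_mul hg hSp).const_mul 2
      have h3 := hSp.integrable_sq
      rw [← integral_const_mul, ← integral_add h1 h2, ← integral_add (by exact h1.add h2) h3]
      refine integral_congr_ae (ae_of_all _ fun ω => ?_)
      ring
    have hadd : MemLp (fun ω => g ω + S (shift^[p] ω)) 2 (prodMeasure μ) := hg.add hSp
    rw [lpNorm_two_sq hadd, hexp,
      ← lpNorm_two_sq hg, ← lpNorm_two_sq hSp, lpNorm_comp_shift_iterate (hS n) p]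
    push_cast
    linarith

/-- The blocks of `p` consecutive coordinates are independent. -/
theorem iIndepFun_blocks {p : ℕ} (hp : 0 < p) :
    iIndepFun (fun (j : ℕ) (ω : ℕ → E) (i : Fin p) => ω (i + j * p)) (prodMeasure μ) := by
  rw [iIndepFun_iff_map_fun_eq_infinitePi_map (by fun_prop)]
  -- Uniqueness of Euclidean division by `p`: distinct pairs (block, position) name distinct
  -- coordinates, so the reindexed family is again a product, which currying splits into blocks.
  have hinj : Function.Injective fun x : ℕ × Fin p => (x.2 : ℕ) + x.1 * p := by
    rintro ⟨j, i⟩ ⟨j', i'⟩ h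
    simp only at h
    have hj : j = j' := by
      have := congrArg (· / p) h
      simpa [Nat.add_mul_div_right _ _ hp, Nat.div_eq_of_lt i.2, Nat.div_eq_of_lt i'.2] using this
    subst hj
    simpa [Fin.ext_iff] using h
  have h1 : (prodMeasure μ).map (fun ω (x : ℕ × Fin p) => ω ((x.2 : ℕ) + x.1 * p)) =
      Measure.infinitePi fun _ : ℕ × Fin p => μ :=
    Measure.map_infinitePi_infinitePi_of_inj (P := fun _ : ℕ => μ) hinj
  have h2 : (prodMeasure μ).map (fun ω (j : ℕ) (i : Fin p) => ω ((i : ℕ) + j * p)) =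
      Measure.infinitePi fun _ : ℕ => Measure.infinitePi fun _ : Fin p => μ := by
    rw [← Measure.infinitePi_map_curry (fun (_ : ℕ) (_ : Fin p) => μ), ← h1,
      Measure.map_map (by fun_prop) (by fun_prop)]
    rfl
  rw [h2]
  congr 1
  funext j
  rw [← Measure.infinitePi_map_eval (fun _ : ℕ => Measure.infinitePi fun _ : Fin p => μ) j, ← h2,
    Measure.map_map (by fun_prop) (by fun_prop)]
  rfl

/-- The translates by multiples of `p` of a function of the first `p` coordinates are
independent. -/
theorem iIndepFun_comp_shift_iterate {Y : (ℕ → E) → ℝ} {p : ℕ} (hp : 0 < p)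
    (hY : StronglyMeasurable[firstCoords E p] Y) :
    iIndepFun (fun (j : ℕ) (ω : ℕ → E) => Y (shift^[j * p] ω)) (prodMeasure μ) := by
  let π : (ℕ → E) → Fin p → E := fun ω i => ω i
  have hle : firstCoords E p ≤ MeasurableSpace.comap π MeasurableSpace.pi := by
    refine iSup₂_le fun j hj => ?_
    have : (fun ω : ℕ → E => ω j) = (fun x : Fin p → E => x ⟨j, hj⟩) ∘ π := rfl
    rw [this, ← MeasurableSpace.comap_comp]
    exact MeasurableSpace.comap_mono (measurable_pi_apply _).comap_le
  -- Doob–Dynkin: `Y` factors through the first `p` coordinates, so its translates are one function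
  -- `y` of independent blocks.
  obtain ⟨y, hy, rfl⟩ := (hY.mono hle).measurable.exists_eq_measurable_comp
  have h := (iIndepFun_blocks (μ := μ) hp).comp (fun _ => y) fun _ => hy
  convert! h using 2 with j
  funext ω
  simp only [Function.comp_apply]
  congr 1
  funext i
  exact shift_iterate_apply _ _ _

end Shift

theorem sum_range_mul_eq_sum_sum {M : Type*} [AddCommMonoid M] (a : ℕ → M) (n p : ℕ) :
    ∑ k ∈ Finset.range (n * p), a k =
      ∑ j ∈ Finset.range n, ∑ i ∈ Finset.range p, a (j * p + i) := by
  induction n with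
  | zero => simp
  | succ n ih => rw [add_one_mul, Finset.sum_range_add, ih, Finset.sum_range_succ]

/-- Compares normalization by the number of complete blocks with normalization by `√n`. -/
theorem tendsto_sqrt_nat_div_div_sqrt {p : ℕ} (hp : 0 < p) :
    Tendsto (fun n : ℕ => √((n / p : ℕ) : ℝ) / √n) atTop (𝓝 (√p)⁻¹) := by
  have h := (tendsto_nat_floor_mul_div_atTop (R := ℝ) (a := (p : ℝ)⁻¹) (by positivity)).comp
    tendsto_natCast_atTop_atTop
  have h2 := (Real.continuous_sqrt.tendsto _).comp h
  rw [Real.sqrt_inv] at h2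
  refine h2.congr fun n => ?_
  simp only [Function.comp_apply]
  rw [Real.sqrt_div (Nat.cast_nonneg _), inv_mul_eq_div, Nat.floor_div_eq_div]

/-! ### Second moment and central limit theorem for sums of i.i.d. blocks. -/

section IIDBlocks

variable {E : Type*} [MeasurableSpace E] {μ : Measure E} [IsProbabilityMeasure μ]
  {Y : (ℕ → E) → ℝ} {p : ℕ}

theorem lpNorm_sum_of_stronglyMeasurable_firstCoords (hp : 0 < p)
    (hYm : StronglyMeasurable[firstCoords E p] Y) (hY : MemLp Y 2 (prodMeasure μ))
    (hY0 : ∫ ω, Y ω ∂(prodMeasure μ) = 0) (n : ℕ) :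
    lpNorm (fun ω => ∑ j ∈ Finset.range n, Y (shift^[j * p] ω)) 2 (prodMeasure μ) =
      √n * lpNorm Y 2 (prodMeasure μ) := by
  have hm : ∀ j, MemLp (fun ω => Y (shift^[j * p] ω)) 2 (prodMeasure μ) :=
    fun j => memLp_comp_shift_iterate hY _
  have hz : ∀ j, ∫ ω, Y (shift^[j * p] ω) ∂(prodMeasure μ) = 0 :=
    fun j => (integral_comp_shift_iterate hY _).trans hY0
  have hS := memLp_finsetSum (Finset.range n) fun j _ => hm j
  have hS0 : ∫ ω, ∑ j ∈ Finset.range n, Y (shift^[j * p] ω) ∂(prodMeasure μ) = 0 := by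
    rw [integral_finsetSum _ fun j _ => (hm j).integrable one_le_two]
    exact Finset.sum_eq_zero fun j _ => hz j
  have hvar := IndepFun.variance_sum (s := Finset.range n) (fun j _ => hm j)
    fun i _ j _ hij => (iIndepFun_comp_shift_iterate (μ := μ) hp hYm).indepFun hij
  have hfun : (∑ j ∈ Finset.range n, fun ω => Y (shift^[j * p] ω)) =
      fun ω => ∑ j ∈ Finset.range n, Y (shift^[j * p] ω) := by
    funext ω
    simp
  rw [hfun, variance_of_integral_eq_zero hS.1.aemeasurable hS0, ← lpNorm_two_sq hS,
    Finset.sum_congr rfl fun j _ => (variance_of_integral_eq_zero (hm j).1.aemeasurable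
      (hz j)).trans (lpNorm_two_sq (hm j)).symm,
    Finset.sum_congr rfl fun j _ => by rw [lpNorm_comp_shift_iterate hY],
    Finset.sum_const, Finset.card_range, nsmul_eq_mul] at hvar
  rw [← Real.sqrt_sq (lpNorm_nonneg (p := 2) (μ := prodMeasure μ)), hvar,
    Real.sqrt_mul (Nat.cast_nonneg _), Real.sqrt_sq lpNorm_nonneg]

theorem tendsto_charFun_sum_of_stronglyMeasurable_firstCoords (hp : 0 < p)
    (hYm : StronglyMeasurable[firstCoords E p] Y) (hY : MemLp Y 2 (prodMeasure μ))
    (hY0 : ∫ ω, Y ω ∂(prodMeasure μ) = 0) (t : ℝ) :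
    Tendsto (fun n : ℕ => charFun ((prodMeasure μ).map
        fun ω => (√n)⁻¹ * ∑ j ∈ Finset.range n, Y (shift^[j * p] ω)) t) atTop
      (𝓝 (Complex.exp (-((lpNorm Y 2 (prodMeasure μ) : ℂ) ^ 2 * t ^ 2 / 2)))) := by
  let X : ℕ → (ℕ → E) → ℝ := fun j ω => Y (shift^[j * p] ω)
  have hX0 : X 0 = Y := by simp [X]
  have hYae := hY.1.aemeasurable
  have hident : ∀ j, IdentDistrib (X j) (X 0) (prodMeasure μ) (prodMeasure μ) := fun j => by
    have hmp := measurePreserving_shift_iterate μ (j * p)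
    rw [hX0]
    refine ⟨(memLp_comp_shift_iterate hY _).1.aemeasurable, hYae, ?_⟩
    have hYae' : AEMeasurable Y ((prodMeasure μ).map shift^[j * p]) := by rwa [hmp.map_eq]
    have := AEMeasurable.map_map_of_aemeasurable hYae' hmp.aemeasurable
    rw [hmp.map_eq] at this
    exact this.symm
  have hvar : Var[X 0; prodMeasure μ] = lpNorm Y 2 (prodMeasure μ) ^ 2 := by
    rw [hX0, variance_of_integral_eq_zero hYae hY0, lpNorm_two_sq hY]
  have hclt := (tendstoInDistribution_inv_sqrt_mul_sum_sub (X := X)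
    (HasLaw.id (μ := gaussianReal 0 Var[X 0; prodMeasure μ].toNNReal)) (hX0 ▸ hY)
    (iIndepFun_comp_shift_iterate hp hYm) hident).tendsto
  have h := ProbabilityMeasure.tendsto_iff_tendsto_charFun.1 hclt t
  simp only [ProbabilityMeasure.coe_mk, Measure.map_id, charFun_gaussianReal, hX0, hY0, mul_zero,
    sub_zero] at h
  convert! h using 2
  rw [← hX0, hvar]
  have : ((Real.toNNReal (lpNorm Y 2 (prodMeasure μ) ^ 2) : ℝ) : ℂ) =
      (lpNorm Y 2 (prodMeasure μ) : ℂ) ^ 2 := by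
    rw [Real.coe_toNNReal _ (sq_nonneg _)]; push_cast; rfl
  rw [hX0, show ((Real.toNNReal (lpNorm Y 2 (prodMeasure μ) ^ 2) : NNReal) : ℂ) = _ from this]
  simp

end IIDBlocks

/-! ### Approximation of ergodic sums by independent blocks. -/

section Approximation

variable {E : Type*} [MeasurableSpace E] (μ : Measure E) [IsProbabilityMeasure μ]
  (f : (ℕ → E) → ℝ)

/-- The sum over `k < p` of the approximations of `f ∘ θ^k` depending only on the first `q`
coordinates. -/
noncomputable def blockSum (q p : ℕ) (ω : ℕ → E) : ℝ :=
  ∑ k ∈ Finset.range p, approx μ f (q - k) (shift^[k] ω)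

/-- The error made in replacing `ergodicSum f p` by `blockSum μ f q p`. -/
noncomputable def blockRemainder (q p : ℕ) (ω : ℕ → E) : ℝ :=
  ∑ k ∈ Finset.range p, remainder μ f (q - k) (shift^[k] ω)

theorem blockRemainder_eq (q p : ℕ) (ω : ℕ → E) :
    blockRemainder μ f q p ω = ergodicSum f p ω - blockSum μ f q p ω := by
  simp only [blockRemainder, ergodicSum, blockSum, remainder, Finset.sum_sub_distrib]

theorem stronglyMeasurable_blockSum {q p : ℕ} (h : p ≤ q) :
    StronglyMeasurable[firstCoords E q] (blockSum μ f q p) := by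
  refine Finset.stronglyMeasurable_fun_sum _ fun k hk => ?_
  have hk := Finset.mem_range.1 hk
  -- As `k < p ≤ q`, the truncated subtraction is exact and `(q - k) + k = q`.
  exact stronglyMeasurable_comp_shift_iterate (r := q - k) stronglyMeasurable_condExp (by omega)

variable {μ f}

theorem memLp_approx (hf : MemLp f 2 (prodMeasure μ)) (r : ℕ) :
    MemLp (approx μ f r) 2 (prodMeasure μ) :=
  hf.condExp one_le_two

theorem memLp_remainder (hf : MemLp f 2 (prodMeasure μ)) (r : ℕ) :
    MemLp (remainder μ f r) 2 (prodMeasure μ) :=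
  hf.sub (memLp_approx hf r)

theorem integral_approx (r : ℕ) :
    ∫ ω, approx μ f r ω ∂(prodMeasure μ) = ∫ ω, f ω ∂(prodMeasure μ) :=
  integral_condExp (firstCoords_le r)

theorem memLp_blockSum (hf : MemLp f 2 (prodMeasure μ)) (q p : ℕ) :
    MemLp (blockSum μ f q p) 2 (prodMeasure μ) :=
  memLp_finsetSum _ fun _ _ => memLp_comp_shift_iterate (memLp_approx hf _) _

theorem memLp_blockRemainder (hf : MemLp f 2 (prodMeasure μ)) (q p : ℕ) :
    MemLp (blockRemainder μ f q p) 2 (prodMeasure μ) :=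
  memLp_finsetSum _ fun _ _ => memLp_comp_shift_iterate (memLp_remainder hf _) _

theorem memLp_ergodicSum (hf : MemLp f 2 (prodMeasure μ)) (n : ℕ) :
    MemLp (ergodicSum f n) 2 (prodMeasure μ) :=
  memLp_finsetSum _ fun _ _ => memLp_comp_shift_iterate hf _

theorem integral_blockSum (hf : MemLp f 2 (prodMeasure μ))
    (hf0 : ∫ ω, f ω ∂(prodMeasure μ) = 0) (q p : ℕ) :
    ∫ ω, blockSum μ f q p ω ∂(prodMeasure μ) = 0 := by
  unfold blockSum
  rw [integral_finsetSum _ fun k _ =>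
    (memLp_comp_shift_iterate (memLp_approx hf _) _).integrable one_le_two]
  refine Finset.sum_eq_zero fun k _ => ?_
  rw [integral_comp_shift_iterate (memLp_approx hf _), integral_approx, hf0]

theorem integral_blockRemainder (hf : MemLp f 2 (prodMeasure μ)) (q p : ℕ) :
    ∫ ω, blockRemainder μ f q p ω ∂(prodMeasure μ) = 0 := by
  unfold blockRemainder
  rw [integral_finsetSum _ fun k _ =>
    (memLp_comp_shift_iterate (memLp_remainder hf _) _).integrable one_le_two]
  refine Finset.sum_eq_zero fun k _ => ?_
  rw [integral_comp_shift_iterate (memLp_remainder hf _)]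
  unfold remainder
  rw [integral_sub (hf.integrable one_le_two) ((memLp_approx hf _).integrable one_le_two),
    integral_approx, sub_self]

theorem lpNorm_sum_comp_shift_le {g : ℕ → (ℕ → E) → ℝ} {m : ℕ → ℕ}
    (hg : ∀ k, MemLp (g k) 2 (prodMeasure μ)) (p : ℕ) :
    lpNorm (fun ω => ∑ k ∈ Finset.range p, g k (shift^[m k] ω)) 2 (prodMeasure μ) ≤
      ∑ k ∈ Finset.range p, lpNorm (g k) 2 (prodMeasure μ) := by
  have h := lpNorm_sum_le (s := Finset.range p) (f := fun k ω => g k (shift^[m k] ω))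
    (fun k _ => memLp_comp_shift_iterate (hg k) (m k)) one_le_two
  rw [Finset.sum_congr rfl fun k _ => lpNorm_comp_shift_iterate (hg k) (m k)] at h
  convert! h using 2
  funext ω
  simp

/-- For `k < p` the index `(j + 1) * p - k` runs backwards through `j * p + 1, …, (j + 1) * p`.
These ranges are disjoint for different `j`, which makes the covariance bounds summable. -/
theorem lpNorm_blockRemainder_le (hf : MemLp f 2 (prodMeasure μ)) (j p : ℕ) :
    lpNorm (blockRemainder μ f ((j + 1) * p) p) 2 (prodMeasure μ) ≤
      ∑ i ∈ Finset.range p, lpNorm (remainder μ f (j * p + i + 1)) 2 (prodMeasure μ) := by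
  refine (lpNorm_sum_comp_shift_le (m := id) (fun k => memLp_remainder hf _) p).trans_eq ?_
  rw [← Finset.sum_range_reflect]
  refine Finset.sum_congr rfl fun k hk => ?_
  have hk := Finset.mem_range.1 hk
  have : (j + 1) * p - (p - 1 - k) = j * p + k + 1 := by
    rw [add_one_mul]
    omega
  rw [this]

/-- The errors of successive blocks are nearly orthogonal. -/
theorem lpNorm_sum_blockRemainder_le (hf : MemLp f 2 (prodMeasure μ)) {A : ℝ}
    (hA : ∀ n, ∑ i ∈ Finset.range n, lpNorm (remainder μ f (i + 1)) 2 (prodMeasure μ) ≤ A)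
    (p n : ℕ) :
    lpNorm (fun ω => ∑ j ∈ Finset.range n, blockRemainder μ f p p (shift^[j * p] ω)) 2
      (prodMeasure μ) ≤ √3 * A * √n := by
  have hA0 : 0 ≤ A := by simpa using hA 0
  have hD := memLp_blockRemainder hf p p
  have hDA : lpNorm (blockRemainder μ f p p) 2 (prodMeasure μ) ≤ A := by
    have h := (lpNorm_blockRemainder_le hf 0 p)
    simp only [zero_add, one_mul, zero_mul] at h
    exact h.trans (hA p)
  have hb : ∀ j, |∫ ω, blockRemainder μ f p p ω *
      blockRemainder μ f p p (shift^[(j + 1) * p] ω) ∂(prodMeasure μ)| ≤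
      (∑ i ∈ Finset.range p, lpNorm (remainder μ f (j * p + i + 1)) 2 (prodMeasure μ)) * A := by
    intro j
    have hle : p ≤ (j + 1) * p := Nat.le_mul_of_pos_left p j.succ_pos
    -- Subtracting this function from the block error refines the conditioning from `p` to `(j + 1)
    -- * p` coordinates, leaving `blockRemainder μ f ((j + 1) * p) p`.
    have hm : StronglyMeasurable[firstCoords E ((j + 1) * p)]
        (fun ω => blockSum μ f ((j + 1) * p) p ω - blockSum μ f p p ω) :=
      (stronglyMeasurable_blockSum μ f hle).sub
        ((stronglyMeasurable_blockSum μ f le_rfl).mono (firstCoords_mono hle))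
    refine (abs_integral_mul_comp_shift_iterate_le hD hD (integral_blockRemainder hf p p) hm
      ((memLp_blockSum hf _ _).sub (memLp_blockSum hf _ _))).trans ?_
    have heq : (fun ω => blockRemainder μ f p p ω -
        (blockSum μ f ((j + 1) * p) p ω - blockSum μ f p p ω)) =
        blockRemainder μ f ((j + 1) * p) p := by
      funext ω
      simp only [blockRemainder_eq]
      ring
    rw [heq]
    exact mul_le_mul (lpNorm_blockRemainder_le hf j p) hDA lpNorm_nonneg
      (Finset.sum_nonneg fun _ _ => lpNorm_nonneg)
  have hB : ∀ n, ∑ j ∈ Finset.range n,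
      (∑ i ∈ Finset.range p, lpNorm (remainder μ f (j * p + i + 1)) 2 (prodMeasure μ)) * A ≤
      A * A := by
    intro n
    rw [← Finset.sum_mul,
      ← sum_range_mul_eq_sum_sum (fun i => lpNorm (remainder μ f (i + 1)) 2 (prodMeasure μ))]
    exact mul_le_mul_of_nonneg_right (hA _) hA0
  have h := lpNorm_sum_comp_shift_sq_le hD hb hB n
  refine le_of_sq_le_sq (h.trans ?_) (by positivity)
  rw [mul_pow, mul_pow, Real.sq_sqrt (by norm_num), Real.sq_sqrt (Nat.cast_nonneg n)]
  have h2 : lpNorm (blockRemainder μ f p p) 2 (prodMeasure μ) ^ 2 ≤ A ^ 2 := by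
    gcongr
    exact lpNorm_nonneg
  -- The constant `√3` comes from one diagonal `A ^ 2` and twice the covariance total `A * A`.
  calc _ ≤ (n : ℝ) * (A ^ 2 + 2 * (A * A)) := by gcongr
    _ = _ := by ring

/-- Decomposition of an ergodic sum into blocks of length `p`. -/
theorem ergodicSum_eq_sum_blocks (p n : ℕ) (ω : ℕ → E) :
    ergodicSum f n ω =
      ∑ j ∈ Finset.range (n / p), blockRemainder μ f p p (shift^[j * p] ω) +
      ∑ j ∈ Finset.range (n / p), blockSum μ f p p (shift^[j * p] ω) +
      ∑ i ∈ Finset.range (n % p), f (shift^[n / p * p + i] ω) := by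
  rw [ergodicSum]
  conv_lhs => rw [← Nat.div_add_mod' n p]
  rw [Finset.sum_range_add, sum_range_mul_eq_sum_sum, ← Finset.sum_add_distrib]
  congr 1
  refine Finset.sum_congr rfl fun j _ => ?_
  rw [blockRemainder_eq, sub_add_cancel, ergodicSum]
  refine Finset.sum_congr rfl fun i _ => ?_
  rw [shift_iterate_iterate, add_comm]

/-- The normalized sum of independent blocks of length `p`. -/
noncomputable def normalizedBlocks (μ : Measure E) [IsProbabilityMeasure μ]
    (f : (ℕ → E) → ℝ) (p n : ℕ) (ω : ℕ → E) : ℝ :=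
  (√p)⁻¹ * ((√(n / p : ℕ))⁻¹ *
    ∑ j ∈ Finset.range (n / p), blockSum μ f p p (shift^[j * p] ω))

theorem memLp_sum_blockSum (hf : MemLp f 2 (prodMeasure μ)) (p n : ℕ) :
    MemLp (fun ω => ∑ j ∈ Finset.range n, blockSum μ f p p (shift^[j * p] ω)) 2
      (prodMeasure μ) :=
  memLp_finsetSum _ fun _ _ => memLp_comp_shift_iterate (memLp_blockSum hf p p) _

theorem memLp_normalizedBlocks (hf : MemLp f 2 (prodMeasure μ)) (p n : ℕ) :
    MemLp (normalizedBlocks μ f p n) 2 (prodMeasure μ) :=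
  ((memLp_sum_blockSum hf p _).const_mul _).const_mul _

theorem tendsto_lpNorm_normalizedBlocks (hf : MemLp f 2 (prodMeasure μ))
    (hf0 : ∫ ω, f ω ∂(prodMeasure μ) = 0) {p : ℕ} (hp : 0 < p) :
    Tendsto (fun n => lpNorm (normalizedBlocks μ f p n) 2 (prodMeasure μ)) atTop
      (𝓝 ((√p)⁻¹ * lpNorm (blockSum μ f p p) 2 (prodMeasure μ))) := by
  refine tendsto_const_nhds.congr' ?_
  filter_upwards [eventually_ge_atTop p] with n hn
  have hN : (0 : ℝ) < √(n / p : ℕ) := Real.sqrt_pos.2 (Nat.cast_pos.2 (Nat.div_pos hn hp))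
  unfold normalizedBlocks
  rw [lpNorm_fun_const_mul, lpNorm_fun_const_mul,
    lpNorm_sum_of_stronglyMeasurable_firstCoords hp (stronglyMeasurable_blockSum μ f le_rfl)
      (memLp_blockSum hf p p) (integral_blockSum hf hf0 p p),
    abs_of_nonneg (by positivity), abs_of_nonneg (by positivity), inv_mul_cancel_left₀ hN.ne']

theorem tendsto_charFun_normalizedBlocks (hf : MemLp f 2 (prodMeasure μ))
    (hf0 : ∫ ω, f ω ∂(prodMeasure μ) = 0) {p : ℕ} (hp : 0 < p) (t : ℝ) :
    Tendsto (fun n => charFun ((prodMeasure μ).map (normalizedBlocks μ f p n)) t) atTop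
      (𝓝 (Complex.exp (-((((√p)⁻¹ * lpNorm (blockSum μ f p p) 2 (prodMeasure μ) : ℝ) : ℂ) ^ 2 *
        t ^ 2 / 2)))) := by
  have h := (tendsto_charFun_sum_of_stronglyMeasurable_firstCoords hp
      (stronglyMeasurable_blockSum μ f le_rfl)
      (memLp_blockSum hf p p) (integral_blockSum hf hf0 p p) ((√p)⁻¹ * t)).comp
    (Nat.tendsto_div_const_atTop hp.ne')
  have hval : Complex.exp (-((((√p)⁻¹ * lpNorm (blockSum μ f p p) 2 (prodMeasure μ) : ℝ) : ℂ) ^ 2 *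
        t ^ 2 / 2)) = Complex.exp (-((lpNorm (blockSum μ f p p) 2 (prodMeasure μ) : ℂ) ^ 2 *
        (((√p)⁻¹ * t : ℝ) : ℂ) ^ 2 / 2)) := by
    push_cast
    ring_nf
  rw [hval]
  refine h.congr fun n => ?_
  exact (charFun_map_mul_comp ((memLp_sum_blockSum hf p (n / p)).const_mul _).1.aemeasurable
    _ _).symm

/-- The three terms come from the block errors, from the fewer than `p` summands after the last
complete block, and from the mismatch between `√n` and `√p * √(n / p)`. -/
theorem lpNorm_sub_normalizedBlocks_le (hf : MemLp f 2 (prodMeasure μ))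
    (hf0 : ∫ ω, f ω ∂(prodMeasure μ) = 0) {A : ℝ}
    (hA : ∀ n, ∑ i ∈ Finset.range n, lpNorm (remainder μ f (i + 1)) 2 (prodMeasure μ) ≤ A)
    {p n : ℕ} (hp : 0 < p) (hn : p ≤ n) :
    lpNorm (fun ω => 1 / √n * ergodicSum f n ω - normalizedBlocks μ f p n ω) 2 (prodMeasure μ) ≤
      √3 * A * (√(n / p : ℕ) / √n) + p * lpNorm f 2 (prodMeasure μ) * (√n)⁻¹ +
        |√(n / p : ℕ) / √n - (√p)⁻¹| * lpNorm (blockSum μ f p p) 2 (prodMeasure μ) := by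
  have hN : (0 : ℝ) < √(n / p : ℕ) := Real.sqrt_pos.2 (Nat.cast_pos.2 (Nat.div_pos hn hp))
  set N := n / p
  set c : ℝ := (√n)⁻¹ - (√p)⁻¹ * (√N)⁻¹ with hc
  set D : (ℕ → E) → ℝ :=
    fun ω => ∑ j ∈ Finset.range N, blockRemainder μ f p p (shift^[j * p] ω)
  set R : (ℕ → E) → ℝ := fun ω => ∑ i ∈ Finset.range (n % p), f (shift^[N * p + i] ω)
  set S : (ℕ → E) → ℝ := fun ω => ∑ j ∈ Finset.range N, blockSum μ f p p (shift^[j * p] ω)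
  have hDm : MemLp D 2 (prodMeasure μ) :=
    memLp_finsetSum _ fun _ _ => memLp_comp_shift_iterate (memLp_blockRemainder hf p p) _
  have hRm : MemLp R 2 (prodMeasure μ) :=
    memLp_finsetSum _ fun _ _ => memLp_comp_shift_iterate hf _
  have hDn : lpNorm D 2 (prodMeasure μ) ≤ √3 * A * √N :=
    lpNorm_sum_blockRemainder_le hf hA p N
  have hRn : lpNorm R 2 (prodMeasure μ) ≤ p * lpNorm f 2 (prodMeasure μ) := by
    refine (lpNorm_sum_comp_shift_le (fun _ => hf) _).trans ?_
    rw [Finset.sum_const, Finset.card_range, nsmul_eq_mul]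
    gcongr
    · exact lpNorm_nonneg
    · exact (Nat.mod_lt n hp).le
  have hSn : lpNorm S 2 (prodMeasure μ) = √N * lpNorm (blockSum μ f p p) 2 (prodMeasure μ) :=
    lpNorm_sum_of_stronglyMeasurable_firstCoords hp (stronglyMeasurable_blockSum μ f le_rfl)
      (memLp_blockSum hf p p) (integral_blockSum hf hf0 p p) N
  have hdec : (fun ω => 1 / √n * ergodicSum f n ω - normalizedBlocks μ f p n ω) =
      ((fun ω => (√n)⁻¹ * D ω) + fun ω => (√n)⁻¹ * R ω) + fun ω => c * S ω := by
    funext ω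
    rw [ergodicSum_eq_sum_blocks (μ := μ) p n ω]
    simp only [normalizedBlocks, Pi.add_apply, hc]
    change 1 / √n * (D ω + S ω + R ω) - (√p)⁻¹ * ((√N)⁻¹ * S ω) = _
    ring
  have h1 : MemLp (fun ω => (√n)⁻¹ * D ω) 2 (prodMeasure μ) := hDm.const_mul _
  have h2 : MemLp (fun ω => (√n)⁻¹ * R ω) 2 (prodMeasure μ) := hRm.const_mul _
  rw [hdec]
  refine (lpNorm_add_le (h1.add h2) one_le_two).trans ?_
  refine (add_le_add_left (lpNorm_add_le h1 one_le_two) _).trans ?_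
  rw [lpNorm_fun_const_mul, lpNorm_fun_const_mul, lpNorm_fun_const_mul, hSn,
    abs_of_nonneg (by positivity : 0 ≤ (√n)⁻¹)]
  have hcN : |c| * (√N * lpNorm (blockSum μ f p p) 2 (prodMeasure μ)) =
      |√N / √n - (√p)⁻¹| * lpNorm (blockSum μ f p p) 2 (prodMeasure μ) := by
    rw [← mul_assoc, ← abs_of_pos hN, ← abs_mul, abs_of_pos hN, hc]
    congr 2
    field_simp
  rw [hcN]
  refine add_le_add_left (add_le_add ?_ ?_) _
  · calc _ ≤ (√n)⁻¹ * (√3 * A * √N) := by gcongr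
      _ = _ := by ring
  · calc _ ≤ (√n)⁻¹ * (p * lpNorm f 2 (prodMeasure μ)) := by gcongr
      _ = _ := by ring

/-- As `n → ∞` only the block errors survive, with limit `√3 * A * (√p)⁻¹`; the `+ 1` leaves room
for a strict inequality. -/
theorem eventually_lpNorm_sub_normalizedBlocks_le (hf : MemLp f 2 (prodMeasure μ))
    (hf0 : ∫ ω, f ω ∂(prodMeasure μ) = 0) {A : ℝ}
    (hA : ∀ n, ∑ i ∈ Finset.range n, lpNorm (remainder μ f (i + 1)) 2 (prodMeasure μ) ≤ A)
    {p : ℕ} (hp : 0 < p) :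
    ∀ᶠ n : ℕ in atTop, lpNorm (fun ω => 1 / √n * ergodicSum f n ω - normalizedBlocks μ f p n ω) 2
      (prodMeasure μ) ≤ (√3 * A + 1) * (√p)⁻¹ := by
  have hq := tendsto_sqrt_nat_div_div_sqrt hp
  have hinv : Tendsto (fun n : ℕ => (√(n : ℝ))⁻¹) atTop (𝓝 0) :=
    tendsto_inv_atTop_zero.comp (Real.tendsto_sqrt_atTop.comp tendsto_natCast_atTop_atTop)
  have hlim := ((hq.const_mul (√3 * A)).add
    (hinv.const_mul (p * lpNorm f 2 (prodMeasure μ)))).add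
      ((hq.sub_const (√p)⁻¹).abs.mul_const (lpNorm (blockSum μ f p p) 2 (prodMeasure μ)))
  rw [sub_self, abs_zero, zero_mul, mul_zero, add_zero, add_zero] at hlim
  have hpos : (0 : ℝ) < (√p)⁻¹ := inv_pos.2 (Real.sqrt_pos.2 (Nat.cast_pos.2 hp))
  filter_upwards [eventually_ge_atTop p,
    (tendsto_order.1 hlim).2 ((√3 * A + 1) * (√p)⁻¹) (by linarith)] with n hn hlt
  exact (lpNorm_sub_normalizedBlocks_le hf hf0 hA hp hn).trans hlt.le

end Approximation

end ShiftCLT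

/-! ### The central limit theorem for the shift. -/

theorem mainTheorem8 {E : Type*} [MeasurableSpace E] (μ : Measure E) [IsProbabilityMeasure μ]
    (f : (ℕ → E) → ℝ)
    (hf : MemLp f 2 (ShiftCLT.prodMeasure μ))
    (hf0 : ∫ ω, f ω ∂(ShiftCLT.prodMeasure μ) = 0)
    (hsum : ∑' r : ℕ,
      eLpNorm (ShiftCLT.remainder μ f (r + 1)) 2 (ShiftCLT.prodMeasure μ) < ∞) :
    ∃ σ : ℝ, 0 ≤ σ ∧
      Tendsto
        (fun n : ℕ =>
          (1 / (n : ℝ)) * ∫ ω, (ShiftCLT.ergodicSum f n ω) ^ 2 ∂(ShiftCLT.prodMeasure μ))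
        atTop (𝓝 (σ ^ 2)) ∧
      (σ ^ 2 ≠ 0 → ∀ t : ℝ,
        Tendsto
          (fun n : ℕ =>
            (ShiftCLT.prodMeasure μ).real
              {ω | (1 / Real.sqrt (n : ℝ)) * ShiftCLT.ergodicSum f n ω ≤ t})
          atTop
          (𝓝 ((1 / (σ * Real.sqrt (2 * Real.pi))) *
            ∫ u in Set.Iic t, Real.exp (-(u ^ 2) / (2 * σ ^ 2))))) := by
  have hsummable : Summable fun r =>
      lpNorm (ShiftCLT.remainder μ f (r + 1)) 2 (ShiftCLT.prodMeasure μ) := by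
    refine (ENNReal.summable_toReal hsum.ne).congr fun r => ?_
    exact toReal_eLpNorm (ShiftCLT.memLp_remainder hf _).1
  have hA : ∀ n, ∑ i ∈ Finset.range n,
      lpNorm (ShiftCLT.remainder μ f (i + 1)) 2 (ShiftCLT.prodMeasure μ) ≤
      ∑' r, lpNorm (ShiftCLT.remainder μ f (r + 1)) 2 (ShiftCLT.prodMeasure μ) :=
    fun n => hsummable.sum_le_tsum _ fun _ _ => lpNorm_nonneg
  have hX : ∀ n : ℕ, MemLp (fun ω => 1 / √n * ShiftCLT.ergodicSum f n ω) 2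
      (ShiftCLT.prodMeasure μ) := fun n => (ShiftCLT.memLp_ergodicSum hf n).const_mul _
  -- Blocks have length `p + 1`, so that every index gives a positive length.
  have hε : Tendsto (fun p : ℕ => (√3 *
      (∑' r, lpNorm (ShiftCLT.remainder μ f (r + 1)) 2 (ShiftCLT.prodMeasure μ)) + 1) *
      (√((p + 1 : ℕ) : ℝ))⁻¹) atTop (𝓝 0) := by
    have hinv : Tendsto (fun n : ℕ => (√(n : ℝ))⁻¹) atTop (𝓝 0) :=
      tendsto_inv_atTop_zero.comp (Real.tendsto_sqrt_atTop.comp tendsto_natCast_atTop_atTop)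
    simpa using (hinv.comp (tendsto_add_atTop_nat 1)).const_mul _
  obtain ⟨σ, hσ0, hσ, hchar⟩ := ShiftCLT.exists_tendsto_of_approx hX
    (fun p n => ShiftCLT.memLp_normalizedBlocks hf (p + 1) n) hε
    (fun p => ShiftCLT.eventually_lpNorm_sub_normalizedBlocks_le hf hf0 hA p.succ_pos)
    (fun p => ShiftCLT.tendsto_lpNorm_normalizedBlocks hf hf0 p.succ_pos)
    (fun p t => ShiftCLT.tendsto_charFun_normalizedBlocks hf hf0 p.succ_pos t)
  refine ⟨σ, hσ0, (hσ.pow 2).congr fun n => ?_, fun hne t => ?_⟩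
  · rw [ShiftCLT.lpNorm_two_sq (hX n), ← integral_const_mul]
    simp_rw [mul_pow, div_pow, Real.sq_sqrt (Nat.cast_nonneg n), one_pow]
  · exact ShiftCLT.tendsto_measureReal_le_of_tendsto_charFun
      (hσ0.lt_of_ne fun h => hne (by rw [← h]; norm_num)) (fun n => (hX n).1.aemeasurable) hchar t
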